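/- Let $k,n$ be nonnegative integers with $k\le n$, let $$\mathrm{Gr}(k,n)=\{Q\in\mathbb R^{n\times n}: Q^{\mathsf T}Q=I,\ Q^{\mathsf T}=Q,\ \operatorname{tr}(Q)=2k-n\},$$ regarded as an embedded submanifold of $\mathbb R^{n\times n}$ with the Riemannian metric $\langle X,Y\rangle_Q=\operatorname{tr}(X^{\mathsf T}Y)=\operatorname{tr}(XY)$ on its tangent spaces $\mathrm T_Q\mathrm{Gr}(k,n)$. Let $f:\mathrm{Gr}(k,n)\to\mathbb R$ be $C^2$ and $Q\in\mathrm{Gr}(k,n)$. The Riemannian Hessian $\nabla^2 f(Q):\mathrm T_Q\mathrm{Gr}(k,n)\times \mathrm T_Q\mathrm{Gr}(k,n)\to\mathbb R$ is the second covariant derivative of $f$ at $Q$ with respect to the Levi-Civita connection, i.e. the unique bilinear form whose components in any local coordinates around $Q$ are $\partial_i\partial_j f-\sum_m\Gamma^m_{ij}\,\partial_m f$, where $\Gamma^m_{ij}$ are the Christoffel symbols of the metric. Then this form exists and is unique, $f$ extends near $Q$ to a $C^2$ function of the matrix $(q_{ij})$ on a neighbourhood of $Q$ in $\mathbb R^{n\times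 n}$, and for every such extension (again denoted $f$), with $$f_Q=\Bigl[\frac{\partial f}{\partial q_{ij}}(Q)\Bigr]_{i,j=1}^n\in\mathbb R^{n\times n},\qquad f_{QQ}(X,Y)=\sum_{i,j,p,l=1}^n\frac{\partial^2 f}{\partial q_{ij}\,\partial q_{pl}}(Q)\,x_{ij}\,y_{pl},$$ we have $$\nabla^2 f(Q)(X,Y)=f_{QQ}(X,Y)-\tfrac12\operatorname{tr}\bigl(f_Q^{\mathsf T}\,Q\,(XY+YX)\bigr)\qquad\text{for all }X,Y\in\mathrm T_Q\mathrm{Gr}(k,n).$$ -/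

import Mathlib

open Topology
open scoped Matrix ContDiff

noncomputable section

namespace InvolutionModel

/-- The space `ℝⁿˣⁿ` of real `n × n` matrices, as arrays of entries, with its usual topology and
differential calculus. Matrix algebra is done after the identification `Matrix.of`. -/
abbrev Mat (n : ℕ) : Type := Fin n → Fin n → ℝ

/-- The Grassmannian in the involution model: symmetric orthogonal matrices of trace `2k - n`. -/
def Gr (k n : ℕ) : Set (Mat n) :=
  {Q | (Matrix.of Q)ᵀ * Matrix.of Q = 1 ∧ (Matrix.of Q)ᵀ = Matrix.of Q ∧
    (Matrix.of Q).trace = 2 * (k : ℝ) - (n : ℝ)}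

/-- The tangent space at `Q` of an embedded submanifold `M`: the space of velocities at `0` of
`C¹` curves in `M` passing through `Q` at time `0`. For a submanifold the set of these velocities
is already a linear subspace; the span is taken so that the type carries a linear structure. -/
def tangentSpace {n : ℕ} (M : Set (Mat n)) (Q : Mat n) : Submodule ℝ (Mat n) :=
  Submodule.span ℝ {X | ∃ γ : ℝ → Mat n,
    ContDiffAt ℝ 1 γ 0 ∧ (∀ᶠ t in 𝓝 (0 : ℝ), γ t ∈ M) ∧ γ 0 = Q ∧ deriv γ 0 = X}

/-- The metric inherited from the trace (Frobenius) inner product; it is `tr (X Y)` on symmetric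
matrices. -/
def metric {n : ℕ} (X Y : Mat n) : ℝ :=
  ((Matrix.of X)ᵀ * Matrix.of Y).trace

/-- The `i`-th partial derivative of `h` at `u`. -/
def pderiv {d : ℕ} {W : Type*} [NormedAddCommGroup W] [NormedSpace ℝ W]
    (i : Fin d) (h : (Fin d → ℝ) → W) (u : Fin d → ℝ) : W :=
  fderiv ℝ h u (Pi.single i 1)

/-- `φ` restricted to the open set `U ⊆ ℝᵈ` is a smooth local parametrization (the inverse of a
chart) of the embedded submanifold `M`: a smooth injective immersion which is a homeomorphism onto
an open subset of `M`. -/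
structure IsLocalParam {n d : ℕ} {M : Set (Mat n)} (U : Set (Fin d → ℝ))
    (φ : (Fin d → ℝ) → M) : Prop where
  isOpen : IsOpen U
  smooth : ContDiffOn ℝ ∞ (fun u => (φ u : Mat n)) U
  immersion : ∀ u ∈ U, Function.Injective (fderiv ℝ (fun u => (φ u : Mat n)) u)
  injOn : Set.InjOn φ U
  isOpen_image : ∀ W ⊆ U, IsOpen W → IsOpen (φ '' W)

/-- `f : M → ℝ` is of class `C²`: it is so in every local parametrization. -/
def IsC2 {n : ℕ} {M : Set (Mat n)} (f : M → ℝ) : Prop :=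
  ∀ (d : ℕ) (U : Set (Fin d → ℝ)) (φ : (Fin d → ℝ) → M), IsLocalParam U φ →
    ContDiffOn ℝ 2 (fun u => f (φ u)) U

/-- The matrix `g_ij` of the Riemannian metric in the coordinates given by `φ`. -/
def gram {n d : ℕ} {M : Set (Mat n)} (φ : (Fin d → ℝ) → M) (u : Fin d → ℝ) :
    Matrix (Fin d) (Fin d) ℝ :=
  Matrix.of fun i j => metric (pderiv i (fun v => (φ v : Mat n)) u)
    (pderiv j (fun v => (φ v : Mat n)) u)

/-- The Christoffel symbol `Γ^m_ij` of the Levi-Civita connection in the coordinates given by `φ`,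
namely `½ ∑ₗ g^{ml} (∂ᵢ g_jl + ∂ⱼ g_il - ∂ₗ g_ij)`. -/
def christoffel {n d : ℕ} {M : Set (Mat n)} (φ : (Fin d → ℝ) → M) (u : Fin d → ℝ)
    (m i j : Fin d) : ℝ :=
  (1 / 2) * ∑ l, (gram φ u)⁻¹ m l *
    (pderiv i (fun v => gram φ v j l) u + pderiv j (fun v => gram φ v i l) u
      - pderiv l (fun v => gram φ v i j) u)

/-- The components `∂ᵢ∂ⱼ f - ∑ₘ Γ^m_ij ∂ₘ f` of the second covariant derivative of `f` in the
coordinates given by `φ`. -/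
def hessCoord {n d : ℕ} {M : Set (Mat n)} (f : M → ℝ) (φ : (Fin d → ℝ) → M) (u : Fin d → ℝ)
    (i j : Fin d) : ℝ :=
  pderiv i (pderiv j (fun v => f (φ v))) u
    - ∑ m, christoffel φ u m i j * pderiv m (fun v => f (φ v)) u

/-- The bilinear form `H` on the tangent space at `Q` is the Riemannian Hessian of `f` at `Q`
(the second covariant derivative of `f` for the Levi-Civita connection): in every local
parametrization around `Q`, its components on the coordinate vectors `∂ᵢφ`, `∂ⱼφ` are
`∂ᵢ∂ⱼ f - ∑ₘ Γ^m_ij ∂ₘ f`. -/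
def IsRiemannianHessianAt {n : ℕ} {M : Set (Mat n)} (f : M → ℝ) (Q : M)
    (H : tangentSpace M (Q : Mat n) →ₗ[ℝ] tangentSpace M (Q : Mat n) →ₗ[ℝ] ℝ) : Prop :=
  ∀ (d : ℕ) (U : Set (Fin d → ℝ)) (φ : (Fin d → ℝ) → M), IsLocalParam U φ →
    ∀ u ∈ U, φ u = Q → ∀ (i j : Fin d) (X Y : tangentSpace M (Q : Mat n)),
      (X : Mat n) = pderiv i (fun v => (φ v : Mat n)) u →
      (Y : Mat n) = pderiv j (fun v => (φ v : Mat n)) u →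
      H X Y = hessCoord f φ u i j

/-- `F`, a function of the `n²` matrix entries, is a `C²` extension of `f : M → ℝ` near `Q`. -/
def IsC2ExtensionAt {n : ℕ} {M : Set (Mat n)} (f : M → ℝ) (Q : M) (F : Mat n → ℝ) : Prop :=
  ContDiffAt ℝ 2 F (Q : Mat n) ∧ ∀ᶠ P : M in 𝓝 Q, F (P : Mat n) = f P

/-- The partial derivative `∂F/∂q_ij` at `Q`. -/
def entryDeriv {n : ℕ} (i j : Fin n) (F : Mat n → ℝ) (Q : Mat n) : ℝ :=
  fderiv ℝ F Q (Pi.single i (Pi.single j 1))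

/-- The matrix `f_Q = [∂F/∂q_ij (Q)]`. -/
def gradMatrix {n : ℕ} (F : Mat n → ℝ) (Q : Mat n) : Matrix (Fin n) (Fin n) ℝ :=
  Matrix.of fun i j => entryDeriv i j F Q

/-- The bilinear form `f_QQ (X, Y) = ∑ (∂²F/∂q_ij ∂q_pl)(Q) x_ij y_pl`. -/
def secondDerivForm {n : ℕ} (F : Mat n → ℝ) (Q X Y : Mat n) : ℝ :=
  ∑ i, ∑ j, ∑ p, ∑ l, entryDeriv i j (entryDeriv p l F) Q * X i j * Y p l

end InvolutionModel

end

/-! Points of `Gr k n` are symmetric involutions, so differentiating `Q² = 1` puts every tangent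
vector at `Q` among the symmetric matrices anticommuting with `Q`. Conversely, each such matrix is
the velocity of a Cayley curve, and the Cayley transform supplies a chart around every point.

Let `p` be a local parametrization with first derivatives `X`, `Y` and mixed second derivative `Z`.
Differentiating `p² = 1` twice gives `QZ + ZQ + XY + YX = 0`. Split `Z = T + N` with `T = ½(Z -
QZQ)` and `N = ½(Z + QZQ)`. Then `T` is tangent, and `N` is normal and equals `-½ Q(XY + YX)`. By
Gauss' formula (`sum_christoffel_smul`) the Christoffel term of the Hessian is `DF(T)`, while the
chain rule gives `∂ᵢ∂ⱼf = D²F(X, Y) + DF(Z)`. The difference is `D²F(X, Y) + DF(N)`, the stated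
formula (`hessCoord_eq_hessForm`).

An extension `F` comes from a smooth left inverse of a chart. The Hessian is unique because
coordinate vectors span the tangent space, and uniqueness makes the formula independent of the
extension. -/

noncomputable section

namespace InvolutionModel

/-! ### Algebra of the Cayley transform for involutions. -/

section MatrixAlgebra
variable {n : ℕ}

/-- For skew `W`, `(1 - W)(1 + W) = 1 + WᵀW` is positive definite. -/
theorem isUnit_det_one_add_of_skew {W : Matrix (Fin n) (Fin n) ℝ} (hW : Wᵀ = -W) :
    IsUnit (1 + W).det := by
  have h : (1 - W) * (1 + W) = 1 + Wᴴ * W := by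
    rw [Matrix.conjTranspose_eq_transpose_of_trivial, hW]; noncomm_ring
  have hp : (1 + Wᴴ * W).PosDef :=
    Matrix.PosDef.one.add_posSemidef (Matrix.posSemidef_conjTranspose_mul_self W)
  have hu := (Matrix.isUnit_iff_isUnit_det _).1 hp.isUnit
  rw [← h, Matrix.det_mul] at hu
  exact isUnit_of_mul_isUnit_right hu

/-- The conjugate of `Q` by `1 + W`. -/
def cayley (Q W : Matrix (Fin n) (Fin n) ℝ) : Matrix (Fin n) (Fin n) ℝ :=
  (1 + W) * Q * (1 + W)⁻¹

/-- The inverse of `cayley Q`, defined where `P + Q` is invertible. -/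
def cayleyInv (Q P : Matrix (Fin n) (Fin n) ℝ) : Matrix (Fin n) (Fin n) ℝ :=
  (P + Q)⁻¹ * (Q - P)

variable {Q W P : Matrix (Fin n) (Fin n) ℝ}

theorem cayley_mul (hW : Wᵀ = -W) : cayley Q W * (1 + W) = (1 + W) * Q := by
  rw [cayley, mul_assoc, Matrix.nonsing_inv_mul _ (isUnit_det_one_add_of_skew hW), mul_one]

theorem cayley_mul_self (hQ2 : Q * Q = 1) (hW : Wᵀ = -W) :
    cayley Q W * cayley Q W = 1 := by
  have hu := isUnit_det_one_add_of_skew hW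
  calc cayley Q W * cayley Q W = cayley Q W * (1 + W) * Q * (1 + W)⁻¹ := by
        simp only [cayley, mul_assoc]
    _ = 1 := by
        rw [cayley_mul hW, mul_assoc _ Q Q, hQ2, mul_one, Matrix.mul_nonsing_inv _ hu]

theorem trace_cayley (hW : Wᵀ = -W) : (cayley Q W).trace = Q.trace := by
  rw [cayley, Matrix.trace_mul_comm, ← mul_assoc,
    Matrix.nonsing_inv_mul _ (isUnit_det_one_add_of_skew hW), one_mul]

theorem transpose_cayley (hQ : Qᵀ = Q) (hW : Wᵀ = -W) (hQW : Q * W = -(W * Q)) :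
    (cayley Q W)ᵀ = cayley Q W := by
  have hu := isUnit_det_one_add_of_skew hW
  have hu' : IsUnit (1 - W).det := by
    have := isUnit_det_one_add_of_skew (W := -W) (by rw [Matrix.transpose_neg, hW])
    rwa [← sub_eq_add_neg] at this
  have ht : (1 - W) * (cayley Q W)ᵀ = Q * (1 - W) := by
    have := congrArg Matrix.transpose (cayley_mul (Q := Q) hW)
    simpa [Matrix.transpose_mul, hW, hQ, ← sub_eq_add_neg] using this
  -- `W²` commutes with `Q`, so both sides equal `(1 - W²)Q`; the invertible outer factors are then
  -- cancelled.
  have hc : (1 - W) * cayley Q W * (1 + W) = (1 - W) * (cayley Q W)ᵀ * (1 + W) := by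
    rw [ht, mul_assoc, cayley_mul hW]
    have h2 : Q * W * W = W * W * Q := by
      rw [hQW, neg_mul, mul_assoc, hQW, mul_neg, neg_neg, mul_assoc]
    calc (1 - W) * ((1 + W) * Q) = Q - W * W * Q := by noncomm_ring
      _ = Q * (1 - W) * (1 + W) := by rw [← h2]; noncomm_ring
  rw [mul_assoc, mul_assoc] at hc
  have h1 := (Matrix.isUnit_iff_isUnit_det _).2 hu
  have h2 := (Matrix.isUnit_iff_isUnit_det _).2 hu'
  exact (h1.mul_right_cancel (h2.mul_left_cancel hc)).symm

/-- Since `Q` is invertible, this shows that the Cayley chart stays where `P + Q` is invertible, the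
domain of its inverse. -/
theorem cayley_add_mul (hW : Wᵀ = -W) (hQW : Q * W = -(W * Q)) :
    (cayley Q W + Q) * (1 + W) = (2 : ℝ) • Q := by
  rw [add_mul, cayley_mul hW, mul_add, hQW, two_smul]; noncomm_ring

theorem isUnit_det_cayley_add (hQ2 : Q * Q = 1) (hW : Wᵀ = -W) (hQW : Q * W = -(W * Q)) :
    IsUnit (cayley Q W + Q).det := by
  refine Matrix.isUnit_det_of_right_inverse (B := (1 + W) * ((1 / 2 : ℝ) • Q)) ?_
  rw [← mul_assoc, cayley_add_mul hW hQW, smul_mul_smul_comm, hQ2]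
  norm_num

/-- With `P = cayley Q W`, anticommutation turns `P(1 + W) = (1 + W)Q` into `(P + Q)W = Q - P`,
which is solved for `W`. -/
theorem cayleyInv_cayley (hQ2 : Q * Q = 1) (hW : Wᵀ = -W) (hQW : Q * W = -(W * Q)) :
    cayleyInv Q (cayley Q W) = W := by
  have h : (cayley Q W + Q) * W = Q - cayley Q W := by
    have := cayley_mul (Q := Q) hW
    rw [mul_add, mul_one, add_mul, one_mul, ← neg_eq_iff_eq_neg.2 hQW] at this
    rw [add_mul, eq_sub_iff_add_eq]
    calc cayley Q W * W + Q * W + cayley Q W = (cayley Q W + cayley Q W * W) + Q * W := by abel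
      _ = Q := by rw [this]; abel
  rw [cayleyInv, ← h, Matrix.nonsing_inv_mul_cancel_left _ _ (isUnit_det_cayley_add hQ2 hW hQW)]

theorem add_mul_cayleyInv (hS : IsUnit (P + Q).det) : (P + Q) * cayleyInv Q P = Q - P := by
  rw [cayleyInv, Matrix.mul_nonsing_inv_cancel_left _ _ hS]

theorem cayleyInv_mul_add (hQ2 : Q * Q = 1) (hP2 : P * P = 1) (hS : IsUnit (P + Q).det) :
    cayleyInv Q P * (P + Q) = -(Q - P) := by
  have h : (Q - P) * (P + Q) = -((P + Q) * (Q - P)) := by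
    simp only [sub_mul, mul_add, add_mul, mul_sub, hQ2, hP2]; abel
  rw [cayleyInv, mul_assoc, h, mul_neg, Matrix.nonsing_inv_mul_cancel_left _ _ hS]

theorem transpose_cayleyInv (hQ : Qᵀ = Q) (hQ2 : Q * Q = 1) (hP : Pᵀ = P) (hP2 : P * P = 1)
    (hS : IsUnit (P + Q).det) : (cayleyInv Q P)ᵀ = -cayleyInv Q P := by
  have h := congrArg Matrix.transpose (add_mul_cayleyInv hS)
  rw [Matrix.transpose_mul, Matrix.transpose_add, Matrix.transpose_sub, hQ, hP] at h
  refine ((Matrix.isUnit_iff_isUnit_det _).2 hS).mul_right_cancel ?_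
  rw [h, neg_mul, cayleyInv_mul_add hQ2 hP2 hS, neg_neg]

/-- `V = cayleyInv Q P` anticommutes with `P + Q` and hence with `Q - P = (P + Q)V`, so also with
their sum `2Q`. -/
theorem mul_cayleyInv (hQ2 : Q * Q = 1) (hP2 : P * P = 1) (hS : IsUnit (P + Q).det) :
    Q * cayleyInv Q P = -(cayleyInv Q P * Q) := by
  have h1 := add_mul_cayleyInv hS
  have h2 := cayleyInv_mul_add hQ2 hP2 hS
  set V := cayleyInv Q P
  have h3 : (Q - P) * V = -(V * (Q - P)) := by
    rw [eq_neg_iff_add_eq_zero, add_comm, ← eq_neg_iff_add_eq_zero]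
    calc V * (Q - P) = V * ((P + Q) * V) := by rw [h1]
      _ = -((Q - P) * V) := by rw [← mul_assoc, h2, neg_mul]
  have h4 : (2 : ℝ) • (Q * V) = (2 : ℝ) • (-(V * Q)) := by
    calc (2 : ℝ) • (Q * V) = (P + Q) * V + (Q - P) * V := by rw [two_smul]; noncomm_ring
      _ = -(V * (P + Q)) - V * (Q - P) := by rw [h1, h2, h3]; abel
      _ = (2 : ℝ) • (-(V * Q)) := by rw [two_smul]; noncomm_ring
  exact smul_right_injective _ (two_ne_zero (α := ℝ)) h4

theorem cayley_cayleyInv (hQ : Qᵀ = Q) (hQ2 : Q * Q = 1) (hP : Pᵀ = P) (hP2 : P * P = 1)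
    (hS : IsUnit (P + Q).det) : cayley Q (cayleyInv Q P) = P := by
  have hV := transpose_cayleyInv hQ hQ2 hP hP2 hS
  have h1 := add_mul_cayleyInv hS
  have h2 := mul_cayleyInv hQ2 hP2 hS
  refine ((Matrix.isUnit_iff_isUnit_det _).2 (isUnit_det_one_add_of_skew hV)).mul_right_cancel ?_
  rw [cayley_mul hV]
  set V := cayleyInv Q P
  calc (1 + V) * Q = Q - Q * V := by rw [h2]; noncomm_ring
    _ = P + (Q - P) - Q * V := by abel
    _ = P * (1 + V) := by rw [← h1]; noncomm_ring

end MatrixAlgebra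

/-! ### Smoothness of matrix operations and rules for partial derivatives. -/

section Calculus

variable {E : Type*} [NormedAddCommGroup E] [NormedSpace ℝ E]

theorem contDiffAt_mat_iff {n : ℕ} {a : E → Mat n} {m : WithTop ℕ∞} {x : E} :
    ContDiffAt ℝ m a x ↔ ∀ i j, ContDiffAt ℝ m (fun v => a v i j) x := by
  simp only [contDiffAt_pi]

theorem contDiffAt_matrix_mul {n : ℕ} {a b : E → Matrix (Fin n) (Fin n) ℝ} {m : WithTop ℕ∞} {x : E}
    (ha : ∀ i j, ContDiffAt ℝ m (fun v => a v i j) x)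
    (hb : ∀ i j, ContDiffAt ℝ m (fun v => b v i j) x) (i j : Fin n) :
    ContDiffAt ℝ m (fun v => (a v * b v) i j) x := by
  simp only [Matrix.mul_apply]
  exact ContDiffAt.sum fun l _ => (ha i l).mul (hb l j)

theorem contDiffAt_det {n : ℕ} {a : E → Matrix (Fin n) (Fin n) ℝ} {m : WithTop ℕ∞} {x : E}
    (ha : ∀ i j, ContDiffAt ℝ m (fun v => a v i j) x) : ContDiffAt ℝ m (fun v => (a v).det) x := by
  simp only [Matrix.det_apply']
  exact ContDiffAt.sum fun σ _ => contDiffAt_const.mul (contDiffAt_prod fun i _ => ha _ _)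

theorem contDiffAt_matrix_inv {n : ℕ} {a : E → Matrix (Fin n) (Fin n) ℝ} {m : WithTop ℕ∞} {x : E}
    (ha : ∀ i j, ContDiffAt ℝ m (fun v => a v i j) x) (hx : (a x).det ≠ 0) (i j : Fin n) :
    ContDiffAt ℝ m (fun v => (a v)⁻¹ i j) x := by
  simp only [Matrix.inv_def, Matrix.smul_apply, smul_eq_mul, Ring.inverse_eq_inv',
    Matrix.adjugate_apply]
  refine ((contDiffAt_det ha).inv hx).mul (contDiffAt_det fun r s => ?_)
  -- An adjugate entry is the determinant of the matrix with row `j` replaced by a constant vector.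
  by_cases h : r = j
  · subst h; simpa using contDiffAt_const
  · simpa [Matrix.updateRow_ne h] using ha r s

/-- Matrix multiplication as a continuous bilinear map. -/
def mulL (n : ℕ) : Mat n →L[ℝ] Mat n →L[ℝ] Mat n :=
  LinearMap.toContinuousBilinearMap <|
    LinearMap.mul ℝ (Matrix (Fin n) (Fin n) ℝ)

/-- The trace inner product as a continuous bilinear map. -/
def metricL (n : ℕ) : Mat n →L[ℝ] Mat n →L[ℝ] ℝ :=
  LinearMap.toContinuousBilinearMap <|
    (LinearMap.mul ℝ (Matrix (Fin n) (Fin n) ℝ)).compr₂ (Matrix.traceLinearMap (Fin n) ℝ ℝ) ∘ₗ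
      (Matrix.transposeLinearEquiv (Fin n) (Fin n) ℝ ℝ).toLinearMap

theorem metricL_apply {n : ℕ} (X Y : Mat n) : metricL n X Y = metric X Y := rfl

/-- Transposition as a continuous linear map. -/
def transposeL (n : ℕ) : Mat n →L[ℝ] Mat n :=
  LinearMap.toContinuousLinearMap <|
    (Matrix.transposeLinearEquiv (Fin n) (Fin n) ℝ ℝ).toLinearMap

variable {F G H : Type*} [NormedAddCommGroup F] [NormedSpace ℝ F] [NormedAddCommGroup G]
  [NormedSpace ℝ G] [NormedAddCommGroup H] [NormedSpace ℝ H]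

theorem pderiv_bilinear {d : ℕ} (B : F →L[ℝ] G →L[ℝ] H) {a : (Fin d → ℝ) → F}
    {b : (Fin d → ℝ) → G} {u : Fin d → ℝ} (ha : DifferentiableAt ℝ a u)
    (hb : DifferentiableAt ℝ b u) (i : Fin d) :
    pderiv i (fun v => B (a v) (b v)) u = B (pderiv i a u) (b u) + B (a u) (pderiv i b u) := by
  unfold pderiv
  rw [(B.hasFDerivAt_of_bilinear ha.hasFDerivAt hb.hasFDerivAt).fderiv]
  simp [add_comm]

theorem pderiv_clm {d : ℕ} (A : F →L[ℝ] G) {a : (Fin d → ℝ) → F}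
    {u : Fin d → ℝ} (ha : DifferentiableAt ℝ a u) (i : Fin d) :
    pderiv i (fun v => A (a v)) u = A (pderiv i a u) := by
  have h := (A.hasFDerivAt.comp u ha.hasFDerivAt).fderiv
  exact congrArg (fun T => T (Pi.single i 1)) h

theorem _root_.Filter.EventuallyEq.pderiv_eq {d : ℕ} {a b : (Fin d → ℝ) → F} {u : Fin d → ℝ}
    (h : a =ᶠ[𝓝 u] b) (i : Fin d) : pderiv i a u = pderiv i b u := by
  unfold pderiv
  rw [h.fderiv_eq]

theorem _root_.Filter.EventuallyEq.pderiv {d : ℕ} {a b : (Fin d → ℝ) → F} {u : Fin d → ℝ}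
    (h : a =ᶠ[𝓝 u] b) (i : Fin d) : pderiv i a =ᶠ[𝓝 u] pderiv i b :=
  h.eventuallyEq_nhds.mono fun _ hv => hv.pderiv_eq i

theorem pderiv_const {d : ℕ} (c : F) (i : Fin d) (u : Fin d → ℝ) :
    pderiv i (fun _ => c) u = 0 := by
  simp [pderiv]

theorem differentiableAt_pderiv {d : ℕ} {a : (Fin d → ℝ) → F} {u : Fin d → ℝ}
    (ha : ContDiffAt ℝ 2 a u) (i : Fin d) : DifferentiableAt ℝ (pderiv i a) u :=
  ((ha.fderiv_right (m := 1) (by norm_num)).differentiableAt (by norm_num)).clm_apply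
    (differentiableAt_const _)

theorem pderiv_pderiv {d : ℕ} {a : (Fin d → ℝ) → F} {u : Fin d → ℝ}
    (ha : ContDiffAt ℝ 2 a u) (i j : Fin d) :
    pderiv i (pderiv j a) u = fderiv ℝ (fderiv ℝ a) u (Pi.single i 1) (Pi.single j 1) := by
  have h := (ha.fderiv_right (m := 1) (by norm_num)).differentiableAt (by norm_num)
  exact pderiv_clm (ContinuousLinearMap.apply ℝ F (Pi.single j (1 : ℝ))) h i

theorem pderiv_comm {d : ℕ} {a : (Fin d → ℝ) → F} {u : Fin d → ℝ}
    (ha : ContDiffAt ℝ 2 a u) (i j : Fin d) :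
    pderiv i (pderiv j a) u = pderiv j (pderiv i a) u := by
  rw [pderiv_pderiv ha, pderiv_pderiv ha]
  exact ha.isSymmSndFDerivAt (by simp) _ _

theorem fderiv_eq_sum_pderiv {d : ℕ} (a : (Fin d → ℝ) → F) (u w : Fin d → ℝ) :
    fderiv ℝ a u w = ∑ i, w i • pderiv i a u := by
  conv_lhs => rw [pi_eq_sum_univ' w]
  simp only [map_sum, map_smul, pderiv]

end Calculus

/-! ### Local parametrizations of a general embedded submanifold. -/

section LocalParam
variable {n d : ℕ} {M : Set (Mat n)} {U : Set (Fin d → ℝ)} {φ : (Fin d → ℝ) → M} {u : Fin d → ℝ}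

theorem IsLocalParam.contDiffAt (hφ : IsLocalParam U φ) (hu : u ∈ U) :
    ContDiffAt ℝ ∞ (fun v => (φ v : Mat n)) u :=
  hφ.smooth.contDiffAt (hφ.isOpen.mem_nhds hu)

theorem IsLocalParam.differentiableAt (hφ : IsLocalParam U φ) (hu : u ∈ U) :
    DifferentiableAt ℝ (fun v => (φ v : Mat n)) u :=
  (hφ.contDiffAt hu).differentiableAt (by simp)

theorem IsLocalParam.continuousAt (hφ : IsLocalParam U φ) (hu : u ∈ U) : ContinuousAt φ u :=
  Topology.IsInducing.subtypeVal.continuousAt_iff.2 (hφ.contDiffAt hu).continuousAt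

/-- The inverse of a local parametrization extends to a smooth map of the ambient space. -/
theorem IsLocalParam.exists_smooth_leftInverse (hφ : IsLocalParam U φ) (hu : u ∈ U) :
    ∃ ψ : Mat n → (Fin d → ℝ), ContDiffAt ℝ ∞ ψ (φ u : Mat n) ∧ (∀ᶠ v in 𝓝 u, ψ (φ v) = v) ∧
      ∀ᶠ P : M in 𝓝 (φ u), φ (ψ (P : Mat n)) = P := by
  -- Composing with a linear left inverse of the derivative gives a self-map of `ℝᵈ` with identity
  -- derivative at `u`, to which the inverse function theorem applies.
  obtain ⟨L, hL⟩ := LinearMap.exists_leftInverse_of_injective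
    (fderiv ℝ (fun v => (φ v : Mat n)) u).toLinearMap (LinearMap.ker_eq_bot.2 (hφ.immersion u hu))
  let L' : Mat n →L[ℝ] (Fin d → ℝ) := LinearMap.toContinuousLinearMap L
  have hc : ContDiffAt ℝ ∞ (fun v => L' (φ v : Mat n)) u :=
    L'.contDiff.contDiffAt.comp u (hφ.contDiffAt hu)
  have hd : HasFDerivAt (fun v => L' (φ v : Mat n))
      ((ContinuousLinearEquiv.refl ℝ (Fin d → ℝ) : (Fin d → ℝ) ≃L[ℝ] (Fin d → ℝ)) :
        (Fin d → ℝ) →L[ℝ] (Fin d → ℝ)) u := by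
    have h := L'.hasFDerivAt.comp u (hφ.differentiableAt hu).hasFDerivAt
    have he : L' ∘L fderiv ℝ (fun v => (φ v : Mat n)) u = ContinuousLinearMap.id ℝ _ := by
      ext1 w
      exact LinearMap.congr_fun hL w
    rwa [he] at h
  have hs := hc.hasStrictFDerivAt' hd (by simp)
  have hleft : ∀ᶠ v in 𝓝 u, hc.localInverse hd (by simp) (L' (φ v : Mat n)) = v :=
    hs.eventually_left_inverse
  refine ⟨fun P => hc.localInverse hd (by simp) (L' P),
    (hc.to_localInverse hd (by simp)).comp (φ u : Mat n) L'.contDiff.contDiffAt, hleft, ?_⟩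
  obtain ⟨W, hW, hWo, huW⟩ := eventually_nhds_iff.1 (hleft.and (hφ.isOpen.mem_nhds hu))
  -- Openness of the image in `M` is what makes the left inverse also a right inverse on a
  -- neighbourhood in `M`.
  have ho := hφ.isOpen_image W (fun v hv => (hW v hv).2) hWo
  filter_upwards [ho.mem_nhds ⟨u, huW, rfl⟩]
  rintro _ ⟨v, hv, rfl⟩
  exact congrArg φ (hW v hv).1

theorem IsLocalParam.pderiv_mem_tangentSpace (hφ : IsLocalParam U φ) (hu : u ∈ U) (i : Fin d) :
    pderiv i (fun v => (φ v : Mat n)) u ∈ tangentSpace M (φ u : Mat n) := by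
  refine Submodule.subset_span ⟨fun t => (φ (u + t • Pi.single i 1) : Mat n), ?_,
    .of_forall fun t => (φ _).2, by simp, ?_⟩
  · have h : ContDiffAt ℝ 1 (fun t : ℝ => u + t • (Pi.single i 1 : Fin d → ℝ)) 0 := by fun_prop
    refine ContDiffAt.comp (0 : ℝ) (g := fun v => (φ v : Mat n)) ?_ h
    simpa using (hφ.contDiffAt hu).of_le (by exact_mod_cast le_top)
  · have h : HasDerivAt (fun t : ℝ => u + t • (Pi.single i 1 : Fin d → ℝ)) (Pi.single i 1) 0 := by
      simpa using ((hasDerivAt_id (0 : ℝ)).smul_const (Pi.single i 1 : Fin d → ℝ)).const_add u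
    have h2 : HasFDerivAt (fun v => (φ v : Mat n)) (fderiv ℝ (fun v => (φ v : Mat n)) u)
        (u + (0 : ℝ) • (Pi.single i 1 : Fin d → ℝ)) := by
      simpa using (hφ.differentiableAt hu).hasFDerivAt
    exact (h2.comp_hasDerivAt (0 : ℝ) h).deriv

/-- A curve `γ` in `M` is locally `φ ∘ (ψ ∘ γ)` with `ψ` the smooth left inverse, so its velocity
lies in the range of the derivative of `φ`. -/
theorem IsLocalParam.tangentSpace_le_span (hφ : IsLocalParam U φ) (hu : u ∈ U) :
    tangentSpace M (φ u : Mat n) ≤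
      Submodule.span ℝ (Set.range fun i => pderiv i (fun v => (φ v : Mat n)) u) := by
  refine Submodule.span_le.2 ?_
  rintro X ⟨γ, hγ, hM, h0, rfl⟩
  obtain ⟨ψ, hψ, hl, hr⟩ := hφ.exists_smooth_leftInverse hu
  have hψu : ψ (φ u) = u := hl.self_of_nhds
  rw [nhds_subtype, Filter.eventually_comap] at hr
  have hγd := (hγ.differentiableAt (by norm_num)).hasDerivAt
  have hev : (fun t => (φ (ψ (γ t)) : Mat n)) =ᶠ[𝓝 0] γ := by
    have hc : Filter.Tendsto γ (𝓝 0) (𝓝 (φ u : Mat n)) := h0 ▸ hγ.continuousAt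
    filter_upwards [hM, hc.eventually hr] with t ht h
    rw [h ⟨γ t, ht⟩ rfl]
  have h1 : HasDerivAt (fun t => ψ (γ t)) (fderiv ℝ ψ (φ u) (deriv γ 0)) 0 := by
    have := (hψ.differentiableAt (by simp)).hasFDerivAt
    rw [← h0] at this ⊢
    exact this.comp_hasDerivAt (0 : ℝ) hγd
  have h2 : HasFDerivAt (fun v => (φ v : Mat n)) (fderiv ℝ (fun v => (φ v : Mat n)) u)
      (ψ (γ 0)) := by
    rw [h0, hψu]; exact (hφ.differentiableAt hu).hasFDerivAt
  have h3 := (h2.comp_hasDerivAt (0 : ℝ) h1).congr_of_eventuallyEq hev.symm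
  rw [h3.deriv, fderiv_eq_sum_pderiv]
  exact Submodule.sum_mem _ fun i _ => Submodule.smul_mem _ _ (Submodule.subset_span ⟨i, rfl⟩)

theorem IsLocalParam.linearIndependent (hφ : IsLocalParam U φ) (hu : u ∈ U) :
    LinearIndependent ℝ fun i => pderiv i (fun v => (φ v : Mat n)) u := by
  rw [Fintype.linearIndependent_iff]
  intro c hc
  rw [← fderiv_eq_sum_pderiv] at hc
  have := hφ.immersion u hu (hc.trans (map_zero _).symm)
  exact fun i => congrFun this i

end LocalParam

/-! ### Cayley charts and tangent spaces of the Grassmannian. -/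

section Grassmannian
variable {k n : ℕ}

theorem Gr_transpose (Q : Gr k n) : (Matrix.of (Q : Mat n))ᵀ = Matrix.of (Q : Mat n) := Q.2.2.1

theorem Gr_mul_self (Q : Gr k n) : Matrix.of (Q : Mat n) * Matrix.of (Q : Mat n) = 1 := by
  have h := Q.2.1
  rwa [Q.2.2.1] at h

/-- The symmetric matrices that anticommute with `Q`. -/
def symmAnti (Q : Mat n) : Submodule ℝ (Mat n) :=
  LinearMap.ker (transposeL n - ContinuousLinearMap.id ℝ (Mat n)).toLinearMap ⊓
    LinearMap.ker (mulL n Q + (mulL n).flip Q).toLinearMap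

theorem mem_symmAnti {Q X : Mat n} : X ∈ symmAnti Q ↔ (Matrix.of X)ᵀ = Matrix.of X ∧
    Matrix.of Q * Matrix.of X = -(Matrix.of X * Matrix.of Q) := by
  rw [eq_neg_iff_add_eq_zero, ← sub_eq_zero]
  rfl

/-- The skew-symmetric matrices that anticommute with `Q`. -/
def skewAnti (Q : Mat n) : Submodule ℝ (Mat n) :=
  LinearMap.ker (transposeL n + ContinuousLinearMap.id ℝ (Mat n)).toLinearMap ⊓
    LinearMap.ker (mulL n Q + (mulL n).flip Q).toLinearMap

theorem mem_skewAnti {Q X : Mat n} : X ∈ skewAnti Q ↔ (Matrix.of X)ᵀ = -Matrix.of X ∧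
    Matrix.of Q * Matrix.of X = -(Matrix.of X * Matrix.of Q) := by
  rw [eq_neg_iff_add_eq_zero, eq_neg_iff_add_eq_zero]
  rfl

theorem cayley_mem_Gr (Q : Gr k n) {W : Mat n} (hW : W ∈ skewAnti (Q : Mat n)) :
    Matrix.of.symm (cayley (Matrix.of (Q : Mat n)) (Matrix.of W)) ∈ Gr k n := by
  obtain ⟨h1, h2⟩ := mem_skewAnti.1 hW
  have ht := transpose_cayley (Gr_transpose Q) h1 h2
  refine ⟨?_, ht, ?_⟩
  · rw [Equiv.apply_symm_apply, ht, cayley_mul_self (Gr_mul_self Q) h1]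
  · rw [Equiv.apply_symm_apply, trace_cayley h1]
    exact Q.2.2.2

/-- The Cayley chart, as a map into the Grassmannian. -/
def cayleyGr (Q : Gr k n) (W : skewAnti (Q : Mat n)) : Gr k n :=
  ⟨Matrix.of.symm (cayley (Matrix.of (Q : Mat n)) (Matrix.of (W : Mat n))), cayley_mem_Gr Q W.2⟩

theorem contDiffAt_cayley (Q : Mat n) {W : Mat n} (hW : (Matrix.of W)ᵀ = -Matrix.of W)
    {m : WithTop ℕ∞} :
    ContDiffAt ℝ m (fun W : Mat n => Matrix.of.symm (cayley (Matrix.of Q) (Matrix.of W))) W := by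
  have h1 : ∀ i j, ContDiffAt ℝ m
      (fun W : Mat n => (1 + Matrix.of W : Matrix (Fin n) (Fin n) ℝ) i j) W := fun i j => by
    simp only [Matrix.add_apply, Matrix.of_apply]; fun_prop
  exact contDiffAt_mat_iff.2 (contDiffAt_matrix_mul
    (contDiffAt_matrix_mul h1 fun i j => contDiffAt_const)
    (contDiffAt_matrix_inv h1 (isUnit_det_one_add_of_skew hW).ne_zero))

theorem contDiffAt_cayleyInv (Q : Mat n) {P : Mat n} (hP : (Matrix.of P + Matrix.of Q).det ≠ 0)
    {m : WithTop ℕ∞} :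
    ContDiffAt ℝ m (fun P : Mat n => Matrix.of.symm (cayleyInv (Matrix.of Q) (Matrix.of P))) P := by
  refine contDiffAt_mat_iff.2 (contDiffAt_matrix_mul (contDiffAt_matrix_inv (fun i j => ?_) hP)
    fun i j => ?_)
  · simp only [Matrix.add_apply, Matrix.of_apply]; fun_prop
  · simp only [Matrix.sub_apply, Matrix.of_apply]; fun_prop

theorem cayleyInv_mem_skewAnti (Q P : Gr k n)
    (hP : (Matrix.of (P : Mat n) + Matrix.of (Q : Mat n)).det ≠ 0) :
    Matrix.of.symm (cayleyInv (Matrix.of (Q : Mat n)) (Matrix.of (P : Mat n))) ∈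
      skewAnti (Q : Mat n) :=
  mem_skewAnti.2 ⟨transpose_cayleyInv (Gr_transpose Q) (Gr_mul_self Q) (Gr_transpose P) (Gr_mul_self P)
    hP.isUnit,
    mul_cayleyInv (Gr_mul_self Q) (Gr_mul_self P) hP.isUnit⟩

/-- The Cayley chart, written in a basis of `skewAnti Q`, is defined on all of `ℝᵈ` because `1 + W`
is always invertible. -/
theorem exists_localParam (Q : Gr k n) :
    ∃ (d : ℕ) (φ : (Fin d → ℝ) → Gr k n), IsLocalParam Set.univ φ ∧ φ 0 = Q := by
  let b := Module.finBasis ℝ (skewAnti (Q : Mat n))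
  -- A linear retraction onto `skewAnti Q` lets the inverse chart be defined on ambient matrices.
  obtain ⟨L, hL⟩ := (skewAnti (Q : Mat n)).subtype.exists_leftInverse_of_injective
    (Submodule.ker_subtype _)
  let e := b.equivFun
  let φ := fun u => cayleyGr Q (e.symm u)
  let ψ : Mat n → (Fin (Module.finrank ℝ (skewAnti (Q : Mat n))) → ℝ) := fun P =>
    (LinearMap.toContinuousLinearMap (e.toLinearMap ∘ₗ L))
      (Matrix.of.symm (cayleyInv (Matrix.of (Q : Mat n)) (Matrix.of P)))
  have hdet : ∀ u, (Matrix.of (φ u : Mat n) + Matrix.of (Q : Mat n)).det ≠ 0 := fun u =>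
    (isUnit_det_cayley_add (Gr_mul_self Q) (mem_skewAnti.1 (e.symm u).2).1
      (mem_skewAnti.1 (e.symm u).2).2).ne_zero
  have hψφ : ∀ u, ψ (φ u) = u := fun u => by
    have h : cayleyInv (Matrix.of (Q : Mat n)) (Matrix.of (φ u : Mat n)) = (e.symm u : Mat n) :=
      cayleyInv_cayley (Gr_mul_self Q) (mem_skewAnti.1 (e.symm u).2).1 (mem_skewAnti.1 (e.symm u).2).2
    have h2 : L (e.symm u : Mat n) = e.symm u := LinearMap.congr_fun hL (e.symm u)
    change e (L (cayleyInv (Matrix.of (Q : Mat n)) (Matrix.of (φ u : Mat n)))) = u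
    rw [h, h2, LinearEquiv.apply_symm_apply]
  have hφψ : ∀ P : Gr k n, (Matrix.of (P : Mat n) + Matrix.of (Q : Mat n)).det ≠ 0 →
      φ (ψ P) = P := fun P hP => by
    have h2 : L (cayleyInv (Matrix.of (Q : Mat n)) (Matrix.of (P : Mat n))) =
      ⟨_, cayleyInv_mem_skewAnti Q P hP⟩ :=
        LinearMap.congr_fun hL ⟨_, cayleyInv_mem_skewAnti Q P hP⟩
    refine Subtype.ext ?_
    change cayley (Matrix.of (Q : Mat n)) (Matrix.of (e.symm (e (L
      (cayleyInv (Matrix.of (Q : Mat n)) (Matrix.of (P : Mat n))))) : Mat n)) = (P : Mat n)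
    rw [LinearEquiv.symm_apply_apply, h2]
    exact cayley_cayleyInv (Gr_transpose Q) (Gr_mul_self Q) (Gr_transpose P) (Gr_mul_self P) hP.isUnit
  have hψc : ∀ P : Mat n, (Matrix.of P + Matrix.of (Q : Mat n)).det ≠ 0 → ContDiffAt ℝ ∞ ψ P :=
    fun P hP => (ContinuousLinearMap.contDiff _).contDiffAt.comp P (contDiffAt_cayleyInv _ hP)
  have hφc : ContDiff ℝ ∞ (fun u => (φ u : Mat n)) := contDiff_iff_contDiffAt.2 fun u =>
    ContDiffAt.comp u (g := fun W : Mat n =>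
      Matrix.of.symm (cayley (Matrix.of (Q : Mat n)) (Matrix.of W)))
      (f := fun u => (e.symm u : Mat n))
      (contDiffAt_cayley (Q : Mat n) (mem_skewAnti.1 (e.symm u).2).1)
      (LinearMap.toContinuousLinearMap
        ((skewAnti (Q : Mat n)).subtype ∘ₗ e.symm.toLinearMap)).contDiff.contDiffAt
  refine ⟨_, φ, ⟨isOpen_univ, hφc.contDiffOn, fun u _ => ?_, ?_, fun W _ hW => ?_⟩, ?_⟩
  -- Differentiating `ψ ∘ φ = id` gives a left inverse of the derivative of `φ`.
  · have h := ((hψc _ (hdet u)).differentiableAt (by simp)).hasFDerivAt.comp u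
      (hφc.differentiable (by simp) u).hasFDerivAt
    have h2 : HasFDerivAt (ψ ∘ fun u => (φ u : Mat n)) (ContinuousLinearMap.id ℝ _) u :=
      (hasFDerivAt_id u).congr_of_eventuallyEq (.of_forall hψφ)
    refine Function.LeftInverse.injective (g := fderiv ℝ ψ (φ u)) fun w => ?_
    exact congrArg (fun T => T w) (h.unique h2)
  · exact fun u _ v _ h => by rw [← hψφ u, ← hψφ v, h]
  · have himg : φ '' W = Subtype.val ⁻¹'
        ({P : Mat n | (Matrix.of P + Matrix.of (Q : Mat n)).det ≠ 0} ∩ ψ ⁻¹' W) := by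
      ext P
      constructor
      · rintro ⟨u, hu, rfl⟩
        exact ⟨hdet u, by simpa [hψφ] using hu⟩
      · exact fun h => ⟨ψ P, h.2, hφψ P h.1⟩
    have ho : IsOpen {P : Mat n | (Matrix.of P + Matrix.of (Q : Mat n)).det ≠ 0} := by
      refine isOpen_ne_fun (Continuous.matrix_det ?_) continuous_const
      exact continuous_id.add continuous_const
    rw [himg]
    refine (ContinuousOn.isOpen_inter_preimage (fun P hP => ?_) ho hW).preimage
      continuous_subtype_val
    exact (hψc P hP).continuousAt.continuousWithinAt
  · refine Subtype.ext ?_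
    simp [φ, cayleyGr, cayley]

/-- Differentiate `γᵀ = γ` and `γ² = 1`. The trace condition adds nothing: the reverse inclusion
also holds. -/
theorem tangentSpace_le_symmAnti (Q : Gr k n) :
    tangentSpace (Gr k n) (Q : Mat n) ≤ symmAnti (Q : Mat n) := by
  refine Submodule.span_le.2 ?_
  rintro X ⟨γ, hγ, hM, h0, rfl⟩
  have hγd := (hγ.differentiableAt (by norm_num)).hasDerivAt
  refine mem_symmAnti.2 ⟨?_, ?_⟩
  · have h1 := (transposeL n).hasFDerivAt.comp_hasDerivAt (0 : ℝ) hγd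
    have h2 := hγd.congr_of_eventuallyEq (f₁ := (transposeL n) ∘ γ)
      (hM.mono fun t ht => ht.2.1)
    exact h1.unique h2
  · have h1 := (mulL n).hasDerivAt_of_bilinear (u := γ) (v := γ) (fun _ => hγd) fun _ => hγd
    have h2 := (hasDerivAt_const (0 : ℝ) (Matrix.of.symm 1 : Mat n)).congr_of_eventuallyEq
      (f₁ := fun t => mulL n (γ t) (γ t)) (hM.mono fun t ht => Gr_mul_self ⟨_, ht⟩)
    have h3 := h1.unique h2
    rw [eq_neg_iff_add_eq_zero, ← h0]
    exact h3

theorem symmAnti_le_tangentSpace (Q : Gr k n) :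
    symmAnti (Q : Mat n) ≤ tangentSpace (Gr k n) (Q : Mat n) := by
  intro X hX
  obtain ⟨hX1, hX2⟩ := mem_symmAnti.1 hX
  let q : Matrix (Fin n) (Fin n) ℝ := Matrix.of (Q : Mat n)
  -- The Cayley curve along `tW` has initial velocity `WQ - QW = -2QW`; setting this equal to `X`
  -- gives `W = -½QX`.
  let W : Mat n := (-(1 / 2 : ℝ)) • (q * Matrix.of X : Matrix (Fin n) (Fin n) ℝ)
  have hq2 : q * q = 1 := (Gr_mul_self Q)
  have hqt : qᵀ = q := (Gr_transpose Q)
  have hqX : q * Matrix.of X = -(Matrix.of X * q) := hX2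
  have hWt : (Matrix.of W)ᵀ = -Matrix.of W := by
    change (-(1 / 2 : ℝ) • (q * Matrix.of X))ᵀ = -(-(1 / 2 : ℝ) • (q * Matrix.of X))
    rw [Matrix.transpose_smul, Matrix.transpose_mul, hX1, hqt, hqX, smul_neg, neg_neg]
  have hqW : q * Matrix.of W = -(1 / 2 : ℝ) • Matrix.of X := by
    change q * (-(1 / 2 : ℝ) • (q * Matrix.of X)) = _
    rw [mul_smul_comm, ← mul_assoc, hq2, one_mul]
  have hWq : Matrix.of W * q = (1 / 2 : ℝ) • Matrix.of X := by
    change -(1 / 2 : ℝ) • (q * Matrix.of X) * q = _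
    rw [hqX, smul_mul_assoc, neg_mul, mul_assoc, hq2, mul_one, smul_neg, neg_smul, neg_neg]
  have hWs : W ∈ skewAnti (Q : Mat n) := by
    refine mem_skewAnti.2 ⟨hWt, ?_⟩
    change q * Matrix.of W = -(Matrix.of W * q)
    rw [hqW, hWq, neg_smul]
  let γ : ℝ → Mat n := fun t => cayleyGr Q (t • ⟨W, hWs⟩)
  have hγ : ContDiffAt ℝ 1 γ 0 := by
    refine ContDiffAt.comp (0 : ℝ)
      (g := fun W : Mat n => Matrix.of.symm (cayley (Matrix.of (Q : Mat n)) (Matrix.of W)))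
      (f := fun t : ℝ => t • W) (contDiffAt_cayley _ ?_) (by fun_prop)
    simp
  have h0 : γ 0 = Q := by simp [γ, cayleyGr, cayley]
  refine Submodule.subset_span ⟨γ, hγ, .of_forall fun t => (cayleyGr Q _).2, h0, ?_⟩
  have hγd := (hγ.differentiableAt (by norm_num)).hasDerivAt
  have hl : HasDerivAt (fun t : ℝ => (Matrix.of.symm 1 : Mat n) + t • W) W 0 := by
    simpa using ((hasDerivAt_id (0 : ℝ)).smul_const W).const_add (Matrix.of.symm 1 : Mat n)
  have h1 := (mulL n).hasDerivAt_of_bilinear (u := γ) (fun _ => hγd) fun _ => hl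
  -- Differentiating `γ(t)(1 + tW) = (1 + tW)Q` avoids differentiating a matrix inverse.
  have h2 := (((mulL n).flip (Q : Mat n)).hasFDerivAt.comp_hasDerivAt (0 : ℝ)
    hl).congr_of_eventuallyEq (f₁ := fun t => mulL n (γ t) (Matrix.of.symm 1 + t • W))
    (.of_forall fun t => cayley_mul (W := t • Matrix.of W) (by
      rw [Matrix.transpose_smul, hWt, smul_neg]))
  have h3 := h1.unique h2
  rw [h0, zero_smul, add_zero] at h3
  have h4 : q * Matrix.of W + Matrix.of (deriv γ 0) * 1 = Matrix.of W * q := h3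
  rw [mul_one, hqW, hWq, neg_smul, neg_add_eq_iff_eq_add, ← add_smul] at h4
  norm_num at h4
  exact h4

end Grassmannian

/-! ### Entrywise derivatives versus Fréchet derivatives. -/

section Entries
variable {n : ℕ}

theorem mat_eq_sum_single (A : Mat n) :
    A = ∑ i, ∑ j, A i j • (Pi.single i (Pi.single j 1) : Mat n) := by
  ext r s
  simp [Finset.sum_apply, Pi.single_apply, ite_apply]

theorem fderiv_eq_trace (F : Mat n → ℝ) (Q A : Mat n) :
    fderiv ℝ F Q A = ((gradMatrix F Q)ᵀ * Matrix.of A).trace := by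
  conv_lhs => rw [mat_eq_sum_single A]
  simp only [map_sum, map_smul, Matrix.trace, Matrix.diag, Matrix.mul_apply, gradMatrix,
    Matrix.transpose_apply, Matrix.of_apply, entryDeriv, smul_eq_mul]
  rw [Finset.sum_comm]
  simp only [mul_comm]

theorem secondDerivForm_eq {F : Mat n → ℝ} {Q : Mat n} (hF : ContDiffAt ℝ 2 F Q) (X Y : Mat n) :
    secondDerivForm F Q X Y = fderiv ℝ (fderiv ℝ F) Q X Y := by
  have hd := (hF.fderiv_right (m := 1) (by norm_num)).differentiableAt (by norm_num)
  have h : ∀ i j p l, entryDeriv i j (entryDeriv p l F) Q = fderiv ℝ (fderiv ℝ F) Q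
      (Pi.single i (Pi.single j 1)) (Pi.single p (Pi.single l 1)) := fun i j p l => by
    have h := ((ContinuousLinearMap.apply ℝ ℝ
      (Pi.single p (Pi.single l 1) : Mat n)).hasFDerivAt.comp Q hd.hasFDerivAt).fderiv
    exact congrArg (fun T => T (Pi.single i (Pi.single j 1))) h
  conv_rhs => rw [mat_eq_sum_single X]
  simp only [secondDerivForm, h, map_sum, map_smul, FunLike.coe_sum, Finset.sum_apply,
    FunLike.coe_smul, Pi.smul_apply, smul_eq_mul]
  refine Finset.sum_congr rfl fun i _ => Finset.sum_congr rfl fun j _ => ?_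
  conv_rhs => rw [mat_eq_sum_single Y]
  simp only [map_sum, map_smul, smul_eq_mul, Finset.mul_sum]
  exact Finset.sum_congr rfl fun p _ => Finset.sum_congr rfl fun l _ => by ring

theorem metric_self_eq_zero {X : Mat n} (h : metric X X = 0) : X = 0 := by
  have := Matrix.trace_conjTranspose_mul_self_eq_zero_iff (A := Matrix.of X)
  rw [Matrix.conjTranspose_eq_transpose_of_trivial] at this
  exact this.1 h

end Entries

/-! ### Christoffel symbols and the Hessian of an embedded submanifold. -/

section Christoffel
variable {n d : ℕ} {M : Set (Mat n)} {U : Set (Fin d → ℝ)} {φ : (Fin d → ℝ) → M} {u : Fin d → ℝ}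

/-- A kernel vector `c` of the Gram matrix makes `∑ cᵢ ∂ᵢφ` a vector of zero norm. -/
theorem isUnit_det_gram
    (h : LinearIndependent ℝ fun i => pderiv i (fun v => (φ v : Mat n)) u) :
    IsUnit (gram φ u).det := by
  rw [isUnit_iff_ne_zero]
  intro h0
  obtain ⟨c, hc, hc0⟩ := Matrix.exists_mulVec_eq_zero_iff.2 h0
  refine hc (funext (Fintype.linearIndependent_iff.1 h c (metric_self_eq_zero ?_)))
  have h1 : c ⬝ᵥ (gram φ u *ᵥ c) = 0 := by rw [hc0, dotProduct_zero]
  rw [← metricL_apply, ← h1]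
  simp only [map_sum, map_smul, FunLike.coe_sum, Finset.sum_apply, FunLike.coe_smul,
    Pi.smul_apply, smul_eq_mul, dotProduct, Matrix.mulVec, gram, Matrix.of_apply, Finset.mul_sum,
    metricL_apply]
  rw [Finset.sum_comm]
  exact Finset.sum_congr rfl fun i _ => Finset.sum_congr rfl fun j _ => by ring

theorem metric_comm (X Y : Mat n) : metric X Y = metric Y X := by
  rw [metric, metric, ← Matrix.trace_transpose, Matrix.transpose_mul, Matrix.transpose_transpose]

theorem pderiv_gram (hφ : ContDiffAt ℝ 2 (fun v => (φ v : Mat n)) u) (i j l : Fin d) :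
    pderiv i (fun v => gram φ v j l) u =
      metric (pderiv i (pderiv j fun v => (φ v : Mat n)) u) (pderiv l (fun v => (φ v : Mat n)) u) +
      metric (pderiv j (fun v => (φ v : Mat n)) u)
        (pderiv i (pderiv l fun v => (φ v : Mat n)) u) :=
  pderiv_bilinear (metricL n) (differentiableAt_pderiv hφ j) (differentiableAt_pderiv hφ l) i

/-- Expanding the three Gram derivatives and using symmetry of second derivatives, all terms cancel
except `2⟨∂ᵢ∂ⱼφ, ∂ₗφ⟩`. -/
theorem christoffel_eq (hφ : ContDiffAt ℝ 2 (fun v => (φ v : Mat n)) u) (m i j : Fin d) :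
    christoffel φ u m i j = ∑ l, (gram φ u)⁻¹ m l *
      metric (pderiv i (pderiv j fun v => (φ v : Mat n)) u)
        (pderiv l (fun v => (φ v : Mat n)) u) := by
  rw [christoffel, Finset.mul_sum]
  refine Finset.sum_congr rfl fun l _ => ?_
  rw [pderiv_gram hφ, pderiv_gram hφ, pderiv_gram hφ, pderiv_comm hφ j i, pderiv_comm hφ l i,
    pderiv_comm hφ l j,
    metric_comm (pderiv i (pderiv l fun v => (φ v : Mat n)) u),
    metric_comm (pderiv i (fun v => (φ v : Mat n)) u)]
  ring

/-- Gauss' formula: the Christoffel symbols are the coordinates of the tangential part of the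
second derivative of the parametrization. -/
theorem sum_christoffel_smul (hφ : ContDiffAt ℝ 2 (fun v => (φ v : Mat n)) u)
    (hli : LinearIndependent ℝ fun i => pderiv i (fun v => (φ v : Mat n)) u) (i j : Fin d)
    {T N : Mat n}
    (hT : T ∈ Submodule.span ℝ (Set.range fun i => pderiv i (fun v => (φ v : Mat n)) u))
    (hN : ∀ l, metric N (pderiv l (fun v => (φ v : Mat n)) u) = 0)
    (hsum : pderiv i (pderiv j fun v => (φ v : Mat n)) u = T + N) :
    ∑ m, christoffel φ u m i j • pderiv m (fun v => (φ v : Mat n)) u = T := by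
  obtain ⟨c, rfl⟩ := (Submodule.mem_span_range_iff_exists_fun ℝ).1 hT
  -- Pairing with `∂ₗφ` removes `N` and leaves the Gram matrix applied to the coordinates `c` of
  -- `T`; its inverse recovers `c`.
  have h : ∀ l, metric (pderiv i (pderiv j fun v => (φ v : Mat n)) u)
      (pderiv l (fun v => (φ v : Mat n)) u) = (gram φ u *ᵥ c) l := fun l => by
    have hN' := hN l
    rw [← metricL_apply] at hN' ⊢
    rw [hsum, map_add, add_apply, hN', add_zero]
    simp only [map_sum, map_smul, FunLike.coe_sum, Finset.sum_apply, FunLike.coe_smul,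
      Pi.smul_apply, smul_eq_mul, Matrix.mulVec, dotProduct, gram, Matrix.of_apply, metricL_apply]
    exact Finset.sum_congr rfl fun m _ => by rw [metric_comm, mul_comm]
  refine Finset.sum_congr rfl fun m _ => ?_
  rw [christoffel_eq hφ]
  simp only [h]
  change ((gram φ u)⁻¹ *ᵥ (gram φ u *ᵥ c)) m • _ = _
  rw [Matrix.mulVec_mulVec, Matrix.nonsing_inv_mul _ (isUnit_det_gram hli), Matrix.one_mulVec]

/-- The chain rule produces `DF(T + N)` from the second derivative of `φ`, and the Christoffel term
subtracts exactly `DF(T)`. This holds for any `M`. -/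
theorem IsLocalParam.hessCoord_eq (hφ : IsLocalParam U φ) (hu : u ∈ U) {f : M → ℝ} {F : Mat n → ℝ}
    (hF : IsC2ExtensionAt f (φ u) F) (i j : Fin d) {T N : Mat n}
    (hT : T ∈ tangentSpace M (φ u : Mat n))
    (hN : ∀ l, metric N (pderiv l (fun v => (φ v : Mat n)) u) = 0)
    (hsum : pderiv i (pderiv j fun v => (φ v : Mat n)) u = T + N) :
    hessCoord f φ u i j = secondDerivForm F (φ u) (pderiv i (fun v => (φ v : Mat n)) u)
      (pderiv j (fun v => (φ v : Mat n)) u) + fderiv ℝ F (φ u) N := by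
  have hφ2 : ContDiffAt ℝ 2 (fun v => (φ v : Mat n)) u :=
    contDiffAt_infty.1 (hφ.contDiffAt hu) 2
  have hev : (fun v => f (φ v)) =ᶠ[𝓝 u] fun v => F (φ v) :=
    ((hφ.continuousAt hu).eventually hF.2).mono fun v hv => hv.symm
  have hFd : ∀ᶠ v in 𝓝 u, DifferentiableAt ℝ F (φ v : Mat n) :=
    (hφ.contDiffAt hu).continuousAt.eventually
      ((hF.1.eventually (by norm_num)).mono fun P hP => hP.differentiableAt (by norm_num))
  have hd1 : ∀ l, pderiv l (fun v => f (φ v)) =ᶠ[𝓝 u]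
      fun v => fderiv ℝ F (φ v) (pderiv l (fun v => (φ v : Mat n)) v) := fun l => by
    refine (hev.pderiv l).trans ?_
    filter_upwards [hFd, hφ.isOpen.mem_nhds hu] with v hv hvU
    exact congrArg (fun T => T (Pi.single l 1))
      (hv.hasFDerivAt.comp v (hφ.differentiableAt hvU).hasFDerivAt).fderiv
  have hFd2 := (hF.1.fderiv_right (m := 1) (by norm_num)).differentiableAt (by norm_num)
  have hd2 : pderiv i (pderiv j fun v => f (φ v)) u =
      fderiv ℝ (fderiv ℝ F) (φ u) (pderiv i (fun v => (φ v : Mat n)) u)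
        (pderiv j (fun v => (φ v : Mat n)) u) +
      fderiv ℝ F (φ u) (pderiv i (pderiv j fun v => (φ v : Mat n)) u) := by
    rw [(hd1 j).pderiv_eq i]
    have hc := hFd2.hasFDerivAt.comp u (hφ.differentiableAt hu).hasFDerivAt
    have h := pderiv_bilinear (ContinuousLinearMap.id ℝ (Mat n →L[ℝ] ℝ)) hc.differentiableAt
      (differentiableAt_pderiv hφ2 j) i
    have h2 : pderiv i (fderiv ℝ F ∘ fun v => (φ v : Mat n)) u =
      fderiv ℝ (fderiv ℝ F) (φ u) (pderiv i (fun v => (φ v : Mat n)) u) :=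
        congrArg (fun T => T (Pi.single i 1)) hc.fderiv
    rw [h2] at h
    exact h
  have hG := sum_christoffel_smul hφ2 (hφ.linearIndependent hu) i j
    (hφ.tangentSpace_le_span hu hT) hN hsum
  have hs : ∑ m, christoffel φ u m i j * pderiv m (fun v => f (φ v)) u = fderiv ℝ F (φ u) T := by
    rw [← hG, map_sum]
    exact Finset.sum_congr rfl fun m _ => by
      rw [map_smul, smul_eq_mul, (hd1 m).self_of_nhds]
  rw [hessCoord, hs, hd2, hsum, map_add, secondDerivForm_eq hF.1]
  ring

end Christoffel

/-! ### The Hessian formula on the Grassmannian. -/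

section Hessian
variable {k n d : ℕ} {U : Set (Fin d → ℝ)} {φ : (Fin d → ℝ) → Gr k n} {u : Fin d → ℝ}

/-- The Hessian formula in terms of an extension of the function. -/
def hessForm (F : Mat n → ℝ) (Q X Y : Mat n) : ℝ :=
  secondDerivForm F Q X Y - (1 / 2) * Matrix.trace ((gradMatrix F Q)ᵀ *
    (Matrix.of Q * (Matrix.of X * Matrix.of Y + Matrix.of Y * Matrix.of X)))

theorem IsLocalParam.hessCoord_eq_hessForm (hφ : IsLocalParam U φ) (hu : u ∈ U) {f : Gr k n → ℝ}
    {F : Mat n → ℝ} (hF : IsC2ExtensionAt f (φ u) F) (i j : Fin d) :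
    hessCoord f φ u i j = hessForm F (φ u) (pderiv i (fun v => (φ v : Mat n)) u)
      (pderiv j (fun v => (φ v : Mat n)) u) := by
  set p : (Fin d → ℝ) → Mat n := fun v => (φ v : Mat n)
  have hp2 : ContDiffAt ℝ 2 p u := contDiffAt_infty.1 (hφ.contDiffAt hu) 2
  have hpd : ∀ i, DifferentiableAt ℝ (pderiv i p) u := differentiableAt_pderiv hp2
  have hta : ∀ {v}, v ∈ U → ∀ i, pderiv i p v ∈ symmAnti (p v) := fun hv i =>
    tangentSpace_le_symmAnti (φ _) (hφ.pderiv_mem_tangentSpace hv i)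
  let q : Matrix (Fin n) (Fin n) ℝ := Matrix.of (p u)
  let X : Matrix (Fin n) (Fin n) ℝ := Matrix.of (pderiv i p u)
  let Y : Matrix (Fin n) (Fin n) ℝ := Matrix.of (pderiv j p u)
  let Z : Matrix (Fin n) (Fin n) ℝ := Matrix.of (pderiv i (pderiv j p) u)
  have hq2 : q * q = 1 := Gr_mul_self (φ u)
  have hqt : qᵀ = q := Gr_transpose (φ u)
  have hZt : Zᵀ = Z := by
    have h : (fun v => transposeL n (pderiv j p v)) =ᶠ[𝓝 u] pderiv j p :=
      Filter.eventually_of_mem (hφ.isOpen.mem_nhds hu) fun v hv => (mem_symmAnti.1 (hta hv j)).1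
    exact (pderiv_clm (transposeL n) (hpd j) i).symm.trans (h.pderiv_eq i)
  -- Derivative in direction `i` of the anticommutation of `p` with `∂ⱼp`, valid throughout `U`.
  have hZ : X * Y + q * Z + (Z * q + Y * X) = 0 := by
    have h : (fun v => mulL n (p v) (pderiv j p v) + mulL n (pderiv j p v) (p v)) =ᶠ[𝓝 u]
        fun _ => 0 := Filter.eventually_of_mem (hφ.isOpen.mem_nhds hu) fun v hv =>
          eq_neg_iff_add_eq_zero.1 (mem_symmAnti.1 (hta hv j)).2
    have h1 := h.pderiv_eq i
    have hpu := hφ.differentiableAt hu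
    have h2 := ((mulL n).hasFDerivAt_of_bilinear hpu.hasFDerivAt
      (hpd j).hasFDerivAt).differentiableAt
    have h3 := ((mulL n).hasFDerivAt_of_bilinear (hpd j).hasFDerivAt
      hpu.hasFDerivAt).differentiableAt
    have h4 : pderiv i (fun v => mulL n (p v) (pderiv j p v) + mulL n (pderiv j p v) (p v)) u =
        pderiv i (fun v => mulL n (p v) (pderiv j p v)) u +
        pderiv i (fun v => mulL n (pderiv j p v) (p v)) u :=
      congrArg (fun T => T (Pi.single i 1)) (fderiv_add h2 h3)
    rw [pderiv_const, h4, pderiv_bilinear _ hpu (hpd j), pderiv_bilinear _ (hpd j) hpu] at h1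
    exact h1
  -- Conjugation by `q` is an involution: `N` is the part of `Z` commuting with `q`, `T` the
  -- anticommuting part.
  let N : Matrix (Fin n) (Fin n) ℝ := (1 / 2 : ℝ) • (Z + q * Z * q)
  let T : Matrix (Fin n) (Fin n) ℝ := (1 / 2 : ℝ) • (Z - q * Z * q)
  have hN : N = -(1 / 2 : ℝ) • (q * (X * Y + Y * X)) := by
    have h : X * Y + Y * X = -(q * Z + Z * q) := by
      rw [eq_neg_iff_add_eq_zero, ← hZ]; abel
    rw [h, mul_neg, smul_neg, neg_smul, neg_neg, mul_add, ← mul_assoc, hq2, one_mul, ← mul_assoc]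
  have hT : T ∈ tangentSpace (Gr k n) (φ u : Mat n) := by
    refine symmAnti_le_tangentSpace _ (mem_symmAnti.2 ⟨?_, ?_⟩)
    · change Tᵀ = T
      simp only [T, Matrix.transpose_smul, Matrix.transpose_sub, Matrix.transpose_mul, hZt, hqt,
        mul_assoc]
    · change q * T = -(T * q)
      simp only [T, mul_smul_comm, smul_mul_assoc, mul_sub, sub_mul]
      rw [mul_assoc (q * Z), hq2, mul_assoc q Z, ← mul_assoc q q, hq2, one_mul, mul_one, ← smul_neg,
        neg_sub]
  have hNl : ∀ l, metric (Matrix.of.symm N) (pderiv l p u) = 0 := fun l => by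
    let V : Matrix (Fin n) (Fin n) ℝ := Matrix.of (pderiv l p u)
    have hV : q * V = -(V * q) := (mem_symmAnti.1 (hta hu l)).2
    change (Nᵀ * V).trace = 0
    -- Move `V` past `q` at the cost of a sign, then cycle the trace and use `q² = 1`; the two
    -- halves of `⟨N, V⟩` cancel.
    have h1 : (q * Z * q * V).trace = -(Z * V).trace := by
      rw [mul_assoc, hV, mul_neg, Matrix.trace_neg, mul_assoc, Matrix.trace_mul_comm]
      simp only [mul_assoc, hq2, mul_one]
    simp only [N, Matrix.transpose_smul, Matrix.transpose_add, Matrix.transpose_mul, hZt, hqt,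
      smul_mul_assoc, add_mul, Matrix.trace_smul, Matrix.trace_add, ← mul_assoc, h1]
    simp
  have hsum : pderiv i (pderiv j p) u = Matrix.of.symm T + Matrix.of.symm N := by
    change Z = T + N
    simp only [T, N, ← smul_add]
    rw [sub_add_add_cancel, ← two_smul ℝ Z, smul_smul]
    norm_num
  rw [hφ.hessCoord_eq hu hF i j hT hNl hsum, hessForm, fderiv_eq_trace, sub_eq_add_neg,
    ← neg_mul]
  congr 1
  change ((gradMatrix F (φ u))ᵀ * N).trace = _
  rw [hN, mul_smul_comm, Matrix.trace_smul, smul_eq_mul]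

/-- Take `F = f ∘ φ ∘ ψ`, with `ψ` an ambient smooth left inverse of a chart `φ`. -/
theorem exists_isC2ExtensionAt {f : Gr k n → ℝ} (hf : IsC2 f) (Q : Gr k n) :
    ∃ F, IsC2ExtensionAt f Q F := by
  obtain ⟨d, φ, hφ, rfl⟩ := exists_localParam Q
  obtain ⟨ψ, hψ, hl, hr⟩ := hφ.exists_smooth_leftInverse (Set.mem_univ 0)
  refine ⟨fun P => f (φ (ψ P)), ?_, hr.mono fun P hP => congrArg f hP⟩
  refine ContDiffAt.comp (φ 0 : Mat n) (g := fun v => f (φ v)) ?_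
    (contDiffAt_infty.1 hψ 2)
  exact (hf d _ φ hφ).contDiffAt Filter.univ_mem

/-- The Hessian formula as a bilinear map on the tangent space. -/
def hessBilin (M : Set (Mat n)) (F : Mat n → ℝ) (Q : Mat n) (hF : ContDiffAt ℝ 2 F Q) :
    tangentSpace M Q →ₗ[ℝ] tangentSpace M Q →ₗ[ℝ] ℝ :=
  LinearMap.mk₂ ℝ (fun X Y => hessForm F Q X Y)
    (fun X X' Y => by
      simp only [hessForm, secondDerivForm_eq hF, Submodule.coe_add, map_add, add_apply,
        ← Matrix.of_add_of, add_mul, mul_add, Matrix.trace_add]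
      ring)
    (fun c X Y => by
      simp only [hessForm, secondDerivForm_eq hF, Submodule.coe_smul, map_smul, smul_apply,
        ← Matrix.smul_of, smul_mul_assoc, mul_smul_comm, ← smul_add, Matrix.trace_smul, smul_eq_mul]
      ring)
    (fun X Y Y' => by
      simp only [hessForm, secondDerivForm_eq hF, Submodule.coe_add, map_add,
        ← Matrix.of_add_of, add_mul, mul_add, Matrix.trace_add]
      ring)
    (fun c X Y => by
      simp only [hessForm, secondDerivForm_eq hF, Submodule.coe_smul, map_smul,
        ← Matrix.smul_of, smul_mul_assoc, mul_smul_comm, ← smul_add, Matrix.trace_smul, smul_eq_mul]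
      ring)

theorem IsRiemannianHessianAt.unique {f : Gr k n → ℝ} {Q : Gr k n}
    {H H' : tangentSpace (Gr k n) (Q : Mat n) →ₗ[ℝ] tangentSpace (Gr k n) (Q : Mat n) →ₗ[ℝ] ℝ}
    (hH : IsRiemannianHessianAt f Q H) (hH' : IsRiemannianHessianAt f Q H') : H = H' := by
  obtain ⟨d, φ, hφ, rfl⟩ := exists_localParam Q
  let e : Fin d → tangentSpace (Gr k n) (φ 0 : Mat n) := fun i =>
    ⟨_, hφ.pderiv_mem_tangentSpace (Set.mem_univ 0) i⟩
  have he : Submodule.span ℝ (Set.range e) = ⊤ := by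
    rw [eq_top_iff]
    rintro ⟨X, hX⟩ -
    obtain ⟨c, hc⟩ := (Submodule.mem_span_range_iff_exists_fun ℝ).1
      (hφ.tangentSpace_le_span (Set.mem_univ 0) hX)
    refine (Submodule.mem_span_range_iff_exists_fun ℝ).2 ⟨c, Subtype.ext ?_⟩
    simpa [e] using hc
  refine LinearMap.ext_on_range he fun i => LinearMap.ext_on_range he fun j => ?_
  rw [hH d _ φ hφ 0 (Set.mem_univ 0) rfl i j _ _ rfl rfl,
    hH' d _ φ hφ 0 (Set.mem_univ 0) rfl i j _ _ rfl rfl]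

theorem isRiemannianHessianAt_hessBilin {f : Gr k n → ℝ} {Q : Gr k n} {F : Mat n → ℝ}
    (hF : IsC2ExtensionAt f Q F) :
    IsRiemannianHessianAt f Q (hessBilin (Gr k n) F (Q : Mat n) hF.1) := by
  rintro d U φ hφ u hu rfl i j X Y hX hY
  rw [hφ.hessCoord_eq_hessForm hu hF, ← hX, ← hY]
  rfl

end Hessian

end InvolutionModel

end

theorem proposition5p2 (k n : ℕ) (f : InvolutionModel.Gr k n → ℝ)
    (hf : InvolutionModel.IsC2 f) (Q : InvolutionModel.Gr k n) :
    ∃ H : InvolutionModel.tangentSpace (InvolutionModel.Gr k n) (Q : InvolutionModel.Mat n) →ₗ[ℝ]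
        InvolutionModel.tangentSpace (InvolutionModel.Gr k n) (Q : InvolutionModel.Mat n) →ₗ[ℝ] ℝ,
      InvolutionModel.IsRiemannianHessianAt f Q H ∧
      (∀ H', InvolutionModel.IsRiemannianHessianAt f Q H' → H' = H) ∧
      (∃ F : InvolutionModel.Mat n → ℝ, InvolutionModel.IsC2ExtensionAt f Q F) ∧
      ∀ F : InvolutionModel.Mat n → ℝ, InvolutionModel.IsC2ExtensionAt f Q F →
        ∀ X Y : InvolutionModel.tangentSpace (InvolutionModel.Gr k n) (Q : InvolutionModel.Mat n),
          H X Y = InvolutionModel.secondDerivForm F Q X Y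
            - (1 / 2) * Matrix.trace ((InvolutionModel.gradMatrix F Q)ᵀ *
                (Matrix.of (Q : InvolutionModel.Mat n) *
                  (Matrix.of (X : InvolutionModel.Mat n) * Matrix.of (Y : InvolutionModel.Mat n)
                    + Matrix.of (Y : InvolutionModel.Mat n)
                      * Matrix.of (X : InvolutionModel.Mat n)))) := by
  obtain ⟨F, hF⟩ := InvolutionModel.exists_isC2ExtensionAt hf Q
  have hH := InvolutionModel.isRiemannianHessianAt_hessBilin hF
  refine ⟨_, hH, fun H' hH' => hH'.unique hH, ⟨F, hF⟩, fun G hG X Y => ?_⟩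
  -- The form was built from one extension `F`; any other extension `G` also yields a Hessian, so
  -- the two forms coincide.
  rw [hH.unique (InvolutionModel.isRiemannianHessianAt_hessBilin hG)]
  rfl
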